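/- Graphs are finite, simple, undirected and have a non-empty vertex set. A non-empty set $M\subseteq V$ is a \emph{module} of $G=(V,E)$ if $\{v,w\}\in E\iff\{v,w'\}\in E$ for all $v\in V\setminus M$ and $w,w'\in M$; it is \emph{proper} if $M\neq V$. For $|V|>1$ and $v\in V$ let $D_G(v)$ be the connected component of $G$ containing $v$ if $G$ is not connected, the connected component of the complement graph $\overline G$ containing $v$ if $\overline G$ is not connected, and the (unique) maximal proper module of $G$ containing $v$ if $G$ and $\overline G$ are both connected. If $V=\{v\}$ let $D_G(v):=\{v\}$. The \emph{modular decomposition} of $G$ is the family of sets given by $D_{0,v}:=V$ and $D_{i+1,v}:=D_{G[D_{i,v}]}(v)$ for $v\in V$. Symmetric transitive closure logic with counting (STC+C) is the following two-sorted logic over finite relational structures $A$ with universe $U(A)$. Structure variables range over $U(A)$ and number variables over the number sort $N(A)=\{0,\dots,|U(A)|\}$. Formulas are built from first-order logic (with quantification over both sorts) by adding * atoms $p\le q$ for number variables $p,q$; * counting formulas $\#\bar u\,\psi=\bar p$ for a tuple $\bar u$ of individual variables and a tuple $\bar p=(p_1,\dots,p_m)$ of number variables, saying that the number of tuples $\bar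 a$ satisfying $\psi$ when assigned to $\bar u$ is $\sum_{j=1}^m p_j\cdot(|U(A)|+1)^{j-1}$; * formulas $[\mathrm{stc}_{\bar u,\bar v}\,\psi](\bar u',\bar v')$ for compatible tuples $\bar u,\bar v,\bar u',\bar v'$ of variables, saying that $(\bar u',\bar v')$ lies in the symmetric transitive closure of the binary relation that $\psi$ defines on tuples via $(\bar u,\bar v)$. A graph is viewed as a structure with universe $V(G)$ and its edge relation as the only relation. **Theorem.** There is an STC+C-formula $\varphi_D(p,x,z)$ over the vocabulary of graphs, with free variables among the number variable $p$ and the distinct structure variables $x,z$, such that for all graphs $G$, all $i\in N(G)$ and all vertices $v\in V(G)$ the set $\{w\in V(G)\mid G\models\varphi_D[i,v,w]\}$ is the set $D_{i,v}$ of the modular decomposition of $G$. -/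

import Mathlib

/-! ### Modules and the recursive modular decomposition of a graph -/

namespace ModDecomp

variable {V : Type*}

/-- A nonempty vertex set `M` is a module of `G` if no vertex outside `M` distinguishes
two vertices of `M`. -/
def IsModule (G : SimpleGraph V) (M : Set V) : Prop :=
  M.Nonempty ∧ ∀ v, v ∉ M → ∀ w ∈ M, ∀ w' ∈ M, (G.Adj v w ↔ G.Adj v w')

/-- Proper modules: modules different from the whole vertex set. -/
def IsProperModule (G : SimpleGraph V) (M : Set V) : Prop :=
  IsModule G M ∧ M ≠ Set.univ

/-- Proper modules that are maximal with respect to inclusion. -/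
def IsMaximalProperModule (G : SimpleGraph V) (M : Set V) : Prop :=
  Maximal (IsProperModule G) M

open Classical in
/-- The set `D_G(v)`: `{v}` if `v` is the only vertex; otherwise the connected component of `v`
in `G` or in the complement of `G`, if one of these graphs is not connected; otherwise the maximal
proper module of `G` that contains `v`. In the last case there is exactly one such module
(`existsUnique_isMaximalProperModule` below), so that the union is this module. -/
noncomputable def part (G : SimpleGraph V) (v : V) : Set V :=
  if Subsingleton V then {v}
  else if ¬ G.Connected then (G.connectedComponentMk v).supp
  else if ¬ Gᶜ.Connected then (Gᶜ.connectedComponentMk v).supp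
  else ⋃₀ {M | IsMaximalProperModule G M ∧ v ∈ M}

/-- The sets `D_{i,v}` of the recursive modular decomposition: `D_{0,v} = V` and
`D_{i+1,v} = D_{G[D_{i,v}]}(v)`. The vertex `v` lies in every `D_{i,v}` (`mem_D` below). -/
noncomputable def D (G : SimpleGraph V) : ℕ → V → Set V
  | 0, _ => Set.univ
  | i + 1, v =>
      {w | ∃ (hv : v ∈ D G i v) (hw : w ∈ D G i v),
        (⟨w, hw⟩ : ↥(D G i v)) ∈ part (G.induce (D G i v)) ⟨v, hv⟩}

/-- A graph whose vertex set splits into two nonempty parts without edges between them is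
not connected. -/
theorem not_connected_of_split (G : SimpleGraph V) (A : Set V) (x y : V) (hx : x ∈ A)
    (hy : y ∉ A) (h : ∀ a ∈ A, ∀ b, b ∉ A → ¬ G.Adj a b) : ¬ G.Connected := by
  intro hc
  obtain ⟨p⟩ := hc.preconnected x y
  have key : ∀ {a b : V}, G.Walk a b → a ∈ A → b ∈ A := by
    intro a b p
    induction p with
    | nil => exact id
    | cons hadj _ ih =>
      intro ha
      exact ih (by_contra fun hb => h _ ha _ hb hadj)
  exact hy (key p hx)

/-- If `G` and its complement are connected and `G` is finite with at least two vertices, then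
every vertex lies in exactly one maximal proper module. -/
theorem existsUnique_isMaximalProperModule [Finite V] [Nontrivial V] (G : SimpleGraph V)
    (hG : G.Connected) (hG' : Gᶜ.Connected) (v : V) :
    ∃! M, IsMaximalProperModule G M ∧ v ∈ M := by
  have hsing : IsProperModule G {v} := by
    refine ⟨⟨Set.singleton_nonempty v, ?_⟩, ?_⟩
    · rintro u - w rfl w' rfl
      rfl
    · intro h
      obtain ⟨w, hw⟩ := exists_ne v
      have hw' : w ∈ ({v} : Set V) := by rw [h]; trivial
      exact hw hw'
  obtain ⟨M, hvM, hM⟩ := (Set.toFinite {M | IsProperModule G M}).exists_le_maximal hsing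
  refine ⟨M, ⟨hM, hvM rfl⟩, ?_⟩
  rintro N ⟨hN, hvN⟩
  have hvM : v ∈ M := hvM rfl
  by_contra hne
  obtain ⟨⟨⟨-, hMm⟩, hMu⟩, hMx⟩ := hM
  obtain ⟨⟨⟨-, hNm⟩, hNu⟩, hNx⟩ := hN
  have hunion : M ∪ N = Set.univ := by
    by_contra hU
    have hmod : IsProperModule G (M ∪ N) := by
      refine ⟨⟨⟨v, Or.inl hvM⟩, ?_⟩, hU⟩
      have aux : ∀ u, u ∉ M ∪ N → ∀ w ∈ M ∪ N, (G.Adj u w ↔ G.Adj u v) := by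
        rintro u hu w (hw | hw)
        · exact hMm u (fun h => hu (Or.inl h)) w hw v hvM
        · exact hNm u (fun h => hu (Or.inr h)) w hw v hvN
      intro u hu w hw w' hw'
      rw [aux u hu w hw, aux u hu w' hw']
    have h1 : M ∪ N ≤ M := hMx hmod Set.subset_union_left
    have h2 : M ∪ N ≤ N := hNx hmod Set.subset_union_right
    exact hne (le_antisymm (Set.subset_union_right.trans h1) (Set.subset_union_left.trans h2))
  have hcov : ∀ u, u ∈ M ∨ u ∈ N := fun u => by
    have : u ∈ M ∪ N := hunion ▸ Set.mem_univ u
    exact this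
  obtain ⟨x, hx⟩ := (Set.ne_univ_iff_exists_notMem M).1 hMu
  obtain ⟨y, hy⟩ := (Set.ne_univ_iff_exists_notMem N).1 hNu
  have hyM : y ∈ M := (hcov y).resolve_right hy
  have huni : ∀ a, a ∉ M → ∀ b ∈ M, (G.Adj a b ↔ G.Adj x y) := by
    intro a ha b hb
    rw [hMm a ha b hb y hyM, G.adj_comm a y, G.adj_comm x y]
    exact hNm y hy a ((hcov a).resolve_left ha) x ((hcov x).resolve_left hx)
  by_cases hxy : G.Adj x y
  · refine not_connected_of_split Gᶜ M y x hyM hx ?_ hG'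
    intro a ha b hb hadj
    exact ((SimpleGraph.compl_adj G a b).1 hadj).2 ((huni b hb a ha).2 hxy).symm
  · refine not_connected_of_split G M y x hyM hx ?_ hG
    intro a ha b hb hadj
    exact hxy ((huni b hb a ha).1 hadj.symm)

theorem mem_part [Finite V] (G : SimpleGraph V) (v : V) : v ∈ part G v := by
  unfold part
  split_ifs with h0 h1 h2
  · rfl
  · have : Nontrivial V := not_subsingleton_iff_nontrivial.1 h0
    obtain ⟨M, hM, -⟩ := existsUnique_isMaximalProperModule G h1 h2 v
    exact Set.mem_sUnion.2 ⟨M, hM, hM.2⟩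
  · rfl
  · rfl

theorem mem_D [Finite V] (G : SimpleGraph V) (i : ℕ) (v : V) : v ∈ D G i v := by
  induction i with
  | zero => exact Set.mem_univ v
  | succ i ih => exact ⟨ih, ih, mem_part _ _⟩

end ModDecomp

/-! ### Symmetric transitive closure logic with counting (STC+C)

The logic is two-sorted. Structure variables and number variables are each named by natural
numbers. Structure variables range over the universe `U` of a finite relational structure, number
variables over the number sort `{0, …, |U|}`. Vocabularies are relational; function symbols
of a language are not used. -/

namespace STCC

open FirstOrder

/-- Individual variables: structure variables and number variables. -/
inductive Var where
  | str (n : ℕ)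
  | num (n : ℕ)
  deriving DecidableEq

/-- A tuple of `k` structure variables and `l` number variables, repetitions allowed. The two
kinds of components are listed separately. In the counting operator the order of the
components is immaterial, and in the `stc` operator all four tuples are reordered in the same way,
so this covers tuples with the sorts in any order. Two tuples are compatible if they have the same
`k` and `l`. -/
structure VarTuple (k l : ℕ) where
  str : Fin k → ℕ
  num : Fin l → ℕ

/-- The set of variables that occur in a tuple. -/
def VarTuple.vars {k l : ℕ} (u : VarTuple k l) : Finset Var :=
  Finset.univ.image (fun i => Var.str (u.str i)) ∪ Finset.univ.image (fun i => Var.num (u.num i))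

/-- A tuple of pairwise distinct variables; only such tuples are bound by an operator. -/
def VarTuple.Distinct {k l : ℕ} (u : VarTuple k l) : Prop :=
  Function.Injective u.str ∧ Function.Injective u.num

/-- STC+C-formulas over the relation symbols of `L`. The remaining connectives and the universal
quantifiers are the usual abbreviations. -/
inductive Formula (L : Language) where
  /-- `x = y` for structure variables -/
  | eqStr (x y : ℕ) : Formula L
  /-- `p = q` for number variables -/
  | eqNum (p q : ℕ) : Formula L
  /-- `R(x₁, …, x_k)` for structure variables -/
  | rel {k : ℕ} (R : L.Relations k) (x : Fin k → ℕ) : Formula L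
  /-- `p ≤ q` for number variables -/
  | le (p q : ℕ) : Formula L
  | neg (ψ : Formula L) : Formula L
  | and (ψ χ : Formula L) : Formula L
  /-- `∃ x ψ` for a structure variable -/
  | exStr (x : ℕ) (ψ : Formula L) : Formula L
  /-- `∃ p ψ` for a number variable -/
  | exNum (p : ℕ) (ψ : Formula L) : Formula L
  /-- `# u ψ = p` for a tuple `u` of individual variables and a tuple `p` of number variables -/
  | count {k l m : ℕ} (u : VarTuple k l) (hu : u.Distinct) (ψ : Formula L)
      (p : Fin m → ℕ) : Formula L
  /-- `[stc_{u,v} ψ](u', v')` for compatible tuples `u, v, u', v'` -/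
  | stc {k l : ℕ} (u v : VarTuple k l) (hu : u.Distinct) (hv : v.Distinct)
      (huv : Disjoint u.vars v.vars) (ψ : Formula L) (u' v' : VarTuple k l) : Formula L

/-- The set of free variables of a formula. -/
def Formula.free {L : Language} : Formula L → Finset Var
  | .eqStr x y => {.str x, .str y}
  | .eqNum p q => {.num p, .num q}
  | .rel _ x => Finset.univ.image (fun i => Var.str (x i))
  | .le p q => {.num p, .num q}
  | .neg ψ => ψ.free
  | .and ψ χ => ψ.free ∪ χ.free
  | .exStr x ψ => ψ.free \ {.str x}
  | .exNum p ψ => ψ.free \ {.num p}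
  | .count u _ ψ p => (ψ.free \ u.vars) ∪ Finset.univ.image (fun i => Var.num (p i))
  | .stc u v _ _ _ ψ u' v' => u'.vars ∪ v'.vars ∪ (ψ.free \ (u.vars ∪ v.vars))

/-- The number sort `{0, …, |U|}` of a finite structure with universe `U`. -/
abbrev NumSort (U : Type*) : Type := Fin (Nat.card U + 1)

/-- An assignment in a structure with universe `U`. -/
structure Assignment (U : Type*) where
  str : ℕ → U
  num : ℕ → NumSort U

/-- Tuples of `k` elements of the universe and `l` elements of the number sort. -/
abbrev Tuple (U : Type*) (k l : ℕ) := (Fin k → U) × (Fin l → NumSort U)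

namespace Assignment

variable {U : Type*}

/-- `α[a/x]` for a structure variable `x`. -/
def setStr (α : Assignment U) (x : ℕ) (a : U) : Assignment U :=
  ⟨Function.update α.str x a, α.num⟩

/-- `α[n/p]` for a number variable `p`. -/
def setNum (α : Assignment U) (p : ℕ) (n : NumSort U) : Assignment U :=
  ⟨α.str, Function.update α.num p n⟩

/-- `α[a/u]` for a tuple `u` of distinct variables: `u_i` is mapped to `a_i`, and all other
variables keep their value. -/
noncomputable def setTuple {k l : ℕ} (α : Assignment U) (u : VarTuple k l) (a : Tuple U k l) :
    Assignment U :=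
  ⟨Function.extend u.str a.1 α.str, Function.extend u.num a.2 α.num⟩

/-- The tuple `α(u)` of values of the variables `u`. -/
def eval {k l : ℕ} (α : Assignment U) (u : VarTuple k l) : Tuple U k l :=
  (fun i => α.str (u.str i), fun i => α.num (u.num i))

end Assignment

/-- The number `∑ n_i (|U|+1)^(i-1)` encoded by the tuple `(n_1, …, n_m)`. -/
noncomputable def numValue {U : Type*} {m : ℕ} (n : Fin m → NumSort U) : ℕ :=
  ∑ i : Fin m, (n i : ℕ) * (Nat.card U + 1) ^ (i : ℕ)

/-- The symmetric transitive closure of a binary relation. -/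
def SymTransClosure {T : Type*} (R : T → T → Prop) : T → T → Prop :=
  Relation.TransGen (Relation.SymmGen R)

/-- Satisfaction `(A, α) ⊨ φ`. -/
noncomputable def Formula.Holds {L : Language} {U : Type*} (A : L.Structure U) :
    Formula L → Assignment U → Prop
  | .eqStr x y, α => α.str x = α.str y
  | .eqNum p q, α => α.num p = α.num q
  | .rel R x, α => A.RelMap R (fun i => α.str (x i))
  | .le p q, α => α.num p ≤ α.num q
  | .neg ψ, α => ¬ ψ.Holds A α
  | .and ψ χ, α => ψ.Holds A α ∧ χ.Holds A α
  | .exStr x ψ, α => ∃ a : U, ψ.Holds A (α.setStr x a)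
  | .exNum p ψ, α => ∃ n : NumSort U, ψ.Holds A (α.setNum p n)
  | .count (k := k) (l := l) u _ ψ p, α =>
      Set.ncard {a : Tuple U k l | ψ.Holds A (α.setTuple u a)} = numValue (fun i => α.num (p i))
  | .stc u v _ _ _ ψ u' v', α =>
      SymTransClosure (fun a b => ψ.Holds A ((α.setTuple u a).setTuple v b))
        (α.eval u') (α.eval v')

end STCC

namespace ModDecomp

/-! ### Strong modules and the sets `part G v` -/

variable {V : Type*}

/-! Following the recursion level by level is avoided: every `D G i v` is described by two vertices.
Components of `G`, components of the complement and maximal proper modules of a graph with both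
connected are all strong, and a strong module of a strong module is strong. So each `D G i v` is
strong, and as long as it contains a vertex other than `v` the next set is strictly smaller.

If `w` lies in `D G i v` but not in `D G (i + 1) v`, then `D G i v` is the set of all `u` such that
`u` lies in the module hull of `v, w` or `w` lies outside the module hull of `v, u`
(`strongHull_eq_D`). The engine is the exchange property `mem_moduleHull_symm_of_notMem_part`. As
`w` varies over the vertices other than `v`, these hulls are sets of the decreasing sequence of the
`D G i v`, so their sizes tell them apart, and the level of a vertex is found by counting sizes
(`mem_D_iff_lt_ncard_hullSizes`).

Only the module hull needs more than first-order logic with counting. It consists of the vertices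
that occur in pairs reachable from `(v, w)` under Gallai's forcing relation
(`mem_moduleHull_iff_exists_transGen`). This relation is symmetric, so `stc` expresses reachability.
The rest is the translation into a formula. -/

theorem isModule_compl {G : SimpleGraph V} {X : Set V} : IsModule Gᶜ X ↔ IsModule G X := by
  have key : ∀ v, v ∉ X → ∀ w ∈ X, (Gᶜ.Adj v w ↔ ¬ G.Adj v w) := by
    intro v hv w hw
    have : v ≠ w := fun h => hv (h ▸ hw)
    simp [SimpleGraph.compl_adj, this]
  refine and_congr_right fun _ => ⟨fun h v hv w hw w' hw' => ?_, fun h v hv w hw w' hw' => ?_⟩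
  · have := h v hv w hw w' hw'
    rw [key v hv w hw, key v hv w' hw'] at this
    exact not_iff_not.1 this
  · rw [key v hv w hw, key v hv w' hw']
    exact not_congr (h v hv w hw w' hw')

/-- A module is strong if it is not overlapped by another module. -/
def IsStrongModule (G : SimpleGraph V) (M : Set V) : Prop :=
  IsModule G M ∧ ∀ Y, IsModule G Y → (Y ∩ M).Nonempty → Y ⊆ M ∨ M ⊆ Y

/-- The intersection of all modules that contain `v` and `w`. -/
def moduleHull (G : SimpleGraph V) (v w : V) : Set V :=
  {u | ∀ X, IsModule G X → v ∈ X → w ∈ X → u ∈ X}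

theorem isModule_univ [Nonempty V] (G : SimpleGraph V) : IsModule G Set.univ :=
  ⟨Set.univ_nonempty, fun v hv => (hv (Set.mem_univ v)).elim⟩

theorem isModule_singleton (G : SimpleGraph V) (v : V) : IsModule G {v} := by
  refine ⟨Set.singleton_nonempty v, ?_⟩
  rintro u - w rfl w' rfl
  rfl

theorem isModule_of_closed {G : SimpleGraph V} {X : Set V} (hne : X.Nonempty)
    (h : ∀ a ∈ X, ∀ b, G.Adj a b → b ∈ X) : IsModule G X :=
  ⟨hne, fun _ hv w hw w' hw' =>
    ⟨fun ha => (hv (h w hw _ ha.symm)).elim, fun ha => (hv (h w' hw' _ ha.symm)).elim⟩⟩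

theorem supp_closed {G : SimpleGraph V} {v a b : V} (ha : a ∈ (G.connectedComponentMk v).supp)
    (h : G.Adj a b) : b ∈ (G.connectedComponentMk v).supp := by
  rw [SimpleGraph.ConnectedComponent.mem_supp_iff, SimpleGraph.ConnectedComponent.eq] at *
  exact h.symm.reachable.trans ha

/-- Let a module `Y` meet the component and also contain some `y` outside it. A neighbour `b` of a
vertex of `Y` in the component must lie in `Y`: otherwise `b` would also be adjacent to `y`. Hence
`Y` spreads along walks over the whole component. -/
theorem isStrongModule_supp (G : SimpleGraph V) (v : V) :
    IsStrongModule G (G.connectedComponentMk v).supp := by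
  refine ⟨isModule_of_closed ⟨v, rfl⟩ fun a ha b h => supp_closed ha h, ?_⟩
  rintro Y hY ⟨c, hcY, hc⟩
  by_contra! hcon
  obtain ⟨y, hyY, hy⟩ := Set.not_subset.1 hcon.1
  refine hcon.2 fun d hd => ?_
  have hreach : G.Reachable c d := by
    rw [SimpleGraph.ConnectedComponent.mem_supp_iff] at hc hd
    exact SimpleGraph.ConnectedComponent.exact (hc.trans hd.symm)
  obtain ⟨p⟩ := hreach
  clear hd
  induction p with
  | nil => exact hcY
  | @cons a b _ hab _ ih =>
    have hb := supp_closed hc hab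
    refine ih ?_ hb
    by_contra hbY
    exact hy (supp_closed hb ((hY.2 _ hbY a hcY y hyY).1 hab.symm))

/-- In a nontrivial graph, the part of `v` is a component of the graph or of its complement, or it
absorbs all proper modules that it meets. -/
theorem part_cases [Finite V] [Nontrivial V] (G : SimpleGraph V) (v : V) :
    (∃ H : SimpleGraph V, (∀ X, IsModule H X ↔ IsModule G X) ∧ ¬ H.Connected ∧
      part G v = (H.connectedComponentMk v).supp) ∨
    (IsProperModule G (part G v) ∧
      ∀ Y, IsProperModule G Y → (Y ∩ part G v).Nonempty → Y ⊆ part G v) := by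
  unfold part
  split_ifs with h0 h1 h2
  · exact (not_subsingleton V h0).elim
  · obtain ⟨M, ⟨hM, hvM⟩, huniq⟩ := existsUnique_isMaximalProperModule G h1 h2 v
    have hU : ⋃₀ {M | IsMaximalProperModule G M ∧ v ∈ M} = M := by
      have : {M | IsMaximalProperModule G M ∧ v ∈ M} = {M} :=
        Set.eq_singleton_iff_unique_mem.2 ⟨⟨hM, hvM⟩, huniq⟩
      rw [this, Set.sUnion_singleton]
    rw [hU]
    refine Or.inr ⟨hM.1, ?_⟩
    rintro Y hY ⟨u, huY, huM⟩
    obtain ⟨N, hYN, hN⟩ := (Set.toFinite {M | IsProperModule G M}).exists_le_maximal hY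
    -- The maximal proper module `N` above `Y` shares `u` with `M`, so uniqueness at `u` gives `N =
    -- M`.
    exact (existsUnique_isMaximalProperModule G h1 h2 u).unique ⟨hN, hYN huY⟩ ⟨hM, huM⟩ ▸ hYN
  · exact Or.inl ⟨Gᶜ, fun _ => isModule_compl, h2, rfl⟩
  · exact Or.inl ⟨G, fun _ => Iff.rfl, h1, rfl⟩

theorem isStrongModule_univ [Nonempty V] (G : SimpleGraph V) : IsStrongModule G Set.univ :=
  ⟨isModule_univ G, fun _ _ _ => Or.inl (Set.subset_univ _)⟩

theorem isStrongModule_part [Finite V] (G : SimpleGraph V) (v : V) :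
    IsStrongModule G (part G v) := by
  have : Nonempty V := ⟨v⟩
  rcases subsingleton_or_nontrivial V with h | h
  · have : part G v = Set.univ := by
      simpa [part, h] using (Set.subsingleton_univ.eq_singleton_of_mem (Set.mem_univ v)).symm
    rw [this]
    exact isStrongModule_univ G
  · rcases part_cases G v with ⟨H, hH, -, hp⟩ | ⟨hp, hmax⟩
    · rw [hp]
      have := isStrongModule_supp H v
      simpa only [IsStrongModule, hH] using this
    · refine ⟨hp.1, fun Y hY hne => ?_⟩
      by_cases hYu : Y = Set.univ
      · exact Or.inr (hYu ▸ Set.subset_univ _)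
      · exact Or.inl (hmax Y ⟨hY, hYu⟩ hne)

theorem part_ne_univ [Finite V] [Nontrivial V] (G : SimpleGraph V) (v : V) :
    part G v ≠ Set.univ := by
  rcases part_cases G v with ⟨H, -, hc, hp⟩ | ⟨hp, -⟩
  · intro h
    refine hc ((SimpleGraph.connected_iff_exists_forall_reachable H).2 ⟨v, fun w => ?_⟩)
    have hw : w ∈ (H.connectedComponentMk v).supp := by rw [← hp, h]; trivial
    rw [SimpleGraph.ConnectedComponent.mem_supp_iff] at hw
    exact (SimpleGraph.ConnectedComponent.exact hw).symm
  · exact hp.2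

/-- If `part G v` absorbs the proper modules that it meets, the only module containing `v` and `w`
is the whole vertex set. Otherwise the parts are components of `H`, and the union of those of `v`
and `u` is a module; it contains `w`, so `w` lies in the component of `u`. A module containing `v`
and `w` meets this strong component but is not inside it, hence contains it and `u`. -/
theorem mem_moduleHull_symm_of_notMem_part [Finite V] (G : SimpleGraph V) {v w u : V}
    (hw : w ∉ part G v) (h : w ∈ moduleHull G v u) : u ∈ moduleHull G v w := by
  have hvw : v ≠ w := fun h => hw (h ▸ mem_part G v)
  have : Nontrivial V := ⟨v, w, hvw⟩
  intro X hX hvX hwX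
  rcases part_cases G v with ⟨H, hH, -, hp⟩ | ⟨hp, hmax⟩
  · rw [hp] at hw
    have hCu := isStrongModule_supp H u
    have hmod : IsModule G ((H.connectedComponentMk v).supp ∪ (H.connectedComponentMk u).supp) := by
      refine (hH _).1 (isModule_of_closed ⟨v, Or.inl rfl⟩ ?_)
      rintro a (ha | ha) b hab
      · exact Or.inl (supp_closed ha hab)
      · exact Or.inr (supp_closed ha hab)
    have hwu : w ∈ (H.connectedComponentMk u).supp :=
      (h _ hmod (Or.inl rfl) (Or.inr rfl)).resolve_left hw
    rcases hCu.2 X ((hH X).2 hX) ⟨w, hwX, hwu⟩ with hs | hs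
    · refine (hw ?_).elim
      have hv := hs hvX
      rw [SimpleGraph.ConnectedComponent.mem_supp_iff] at hv hwu ⊢
      exact hwu.trans hv.symm
    · exact hs rfl
  · by_cases hXu : X = Set.univ
    · exact hXu ▸ Set.mem_univ u
    · exact (hw (hmax X ⟨hX, hXu⟩ ⟨v, hvX, mem_part G v⟩ hwX)).elim

/-! ### Modules of an induced subgraph -/

theorem IsModule.preimage_val {G : SimpleGraph V} {M X : Set V} (hX : IsModule G X)
    (hne : (X ∩ M).Nonempty) : IsModule (G.induce M) (Subtype.val ⁻¹' X) := by
  obtain ⟨u, huX, huM⟩ := hne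
  exact ⟨⟨⟨u, huM⟩, huX⟩, fun v hv w hw w' hw' => hX.2 v hv w hw w' hw'⟩

theorem IsModule.image_val {G : SimpleGraph V} {M : Set V} {X : Set M} (hM : IsModule G M)
    (hX : IsModule (G.induce M) X) : IsModule G (Subtype.val '' X) := by
  refine ⟨hX.1.image _, ?_⟩
  rintro v hv _ ⟨w, hw, rfl⟩ _ ⟨w', hw', rfl⟩
  by_cases hvM : v ∈ M
  · exact hX.2 ⟨v, hvM⟩ (fun h => hv ⟨_, h, rfl⟩) w hw w' hw'
  · exact hM.2 v hvM w w.2 w' w'.2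

/-- A module `Y` that meets `X` either contains `M`, or lies inside `M` and can be compared with `X`
there. -/
theorem IsStrongModule.image_val {G : SimpleGraph V} {M : Set V} {X : Set M}
    (hM : IsStrongModule G M) (hX : IsStrongModule (G.induce M) X) :
    IsStrongModule G (Subtype.val '' X) := by
  refine ⟨hM.1.image_val hX.1, ?_⟩
  rintro Y hY ⟨_, huY, u, huX, rfl⟩
  rcases hM.2 Y hY ⟨u, huY, u.2⟩ with h | h
  · rcases hX.2 _ (hY.preimage_val ⟨u, huY, u.2⟩) ⟨u, huY, huX⟩ with h' | h'
    · exact Or.inl fun y hy => ⟨⟨y, h hy⟩, h' hy, rfl⟩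
    · exact Or.inr (Set.image_subset_iff.2 h')
  · exact Or.inr ((Subtype.coe_image_subset M X).trans h)

/-- Allows the exchange property, a statement about `part` of a whole graph, to be used inside
`G.induce (D G i v)`. -/
theorem mem_moduleHull_induce {G : SimpleGraph V} {M : Set V} (hM : IsModule G M) (v w u : M) :
    u ∈ moduleHull (G.induce M) v w ↔ (u : V) ∈ moduleHull G v w := by
  refine ⟨fun h X hX hv hw => h _ (hX.preimage_val ⟨v, hv, v.2⟩) hv hw, fun h X hX hv hw => ?_⟩
  have := h _ (hM.image_val hX) ⟨v, hv, rfl⟩ ⟨w, hw, rfl⟩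
  simpa using this

theorem moduleHull_self (G : SimpleGraph V) (v : V) : moduleHull G v v = {v} := by
  ext u
  refine ⟨fun h => h _ (isModule_singleton G v) rfl rfl, ?_⟩
  rintro rfl X - h -
  exact h

theorem left_mem_moduleHull (G : SimpleGraph V) (v w : V) : v ∈ moduleHull G v w :=
  fun _ _ h _ => h

/-! ### The sets of the modular decomposition -/

theorem D_succ_eq (G : SimpleGraph V) (i : ℕ) (v : V) (hv : v ∈ D G i v) :
    D G (i + 1) v = Subtype.val '' part (G.induce (D G i v)) ⟨v, hv⟩ := by
  ext w
  constructor
  · rintro ⟨_, hw, h⟩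
    exact ⟨⟨w, hw⟩, h, rfl⟩
  · rintro ⟨⟨w, hw⟩, h, rfl⟩
    exact ⟨hv, hw, h⟩

theorem D_antitone (G : SimpleGraph V) (v : V) : Antitone fun i => D G i v :=
  antitone_nat_of_succ_le fun _ _ h => h.2.1

theorem isStrongModule_D [Finite V] (G : SimpleGraph V) (i : ℕ) (v : V) :
    IsStrongModule G (D G i v) := by
  induction i with
  | zero =>
    have : Nonempty V := ⟨v⟩
    exact isStrongModule_univ G
  | succ i ih =>
    rw [D_succ_eq G i v (mem_D G i v)]
    exact ih.image_val (isStrongModule_part _ _)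

theorem D_succ_ssubset [Finite V] (G : SimpleGraph V) {i : ℕ} {v w : V} (hw : w ∈ D G i v)
    (hne : w ≠ v) : D G (i + 1) v ⊂ D G i v := by
  refine ⟨D_antitone G v i.le_succ, fun h => ?_⟩
  have hv := mem_D G i v
  have : Nontrivial (D G i v) := ⟨⟨w, hw⟩, ⟨v, hv⟩, fun h => hne (congrArg Subtype.val h)⟩
  refine part_ne_univ (G.induce (D G i v)) ⟨v, hv⟩ (Set.eq_univ_of_forall fun u => ?_)
  obtain ⟨_, _, hu⟩ := h u.2
  exact hu

/-- The set of all `u` that belong to the smallest strong module containing `v` and `w`. -/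
def strongHull (G : SimpleGraph V) (v w : V) : Set V :=
  {u | u ∈ moduleHull G v w ∨ w ∉ moduleHull G v u}

theorem strongHull_self (G : SimpleGraph V) (v : V) : strongHull G v v = {v} := by
  ext u
  simp [strongHull, moduleHull_self, left_mem_moduleHull]

/-- If `w` is outside the hull of `v, u`, some module contains `v` and `u` but not `w`; it cannot
contain the strong module `D G i v`, so it lies inside it. Conversely, a vertex `u` of `D G i v`
violating both alternatives would contradict the exchange property in the induced subgraph. -/
theorem strongHull_eq_D [Finite V] (G : SimpleGraph V) {i : ℕ} {v w : V} (hw : w ∈ D G i v)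
    (hw' : w ∉ D G (i + 1) v) : strongHull G v w = D G i v := by
  have hs := isStrongModule_D G i v
  have hv := mem_D G i v
  ext u
  constructor
  · rintro (h | h)
    · exact h _ hs.1 hv hw
    · have : ∃ X, IsModule G X ∧ v ∈ X ∧ u ∈ X ∧ w ∉ X := by
        simpa [moduleHull] using h
      obtain ⟨X, hX, hvX, huX, hwX⟩ := this
      exact (hs.2 X hX ⟨v, hvX, hv⟩).resolve_right (fun h => hwX (h hw)) huX
  · intro hu
    by_contra hcon
    simp only [strongHull, Set.mem_ofPred_eq, not_or, not_not] at hcon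
    refine hcon.1 ((mem_moduleHull_induce hs.1 ⟨v, hv⟩ ⟨w, hw⟩ ⟨u, hu⟩).1 ?_)
    exact mem_moduleHull_symm_of_notMem_part _ (fun h => hw' ⟨hv, hw, h⟩)
      ((mem_moduleHull_induce hs.1 ⟨v, hv⟩ ⟨u, hu⟩ ⟨w, hw⟩).2 hcon.2)

theorem exists_notMem_D [Finite V] (G : SimpleGraph V) {v w : V} (hne : w ≠ v) :
    ∃ i, w ∉ D G i v := by
  by_contra! h
  have hanti : StrictAnti fun i => D G i v :=
    strictAnti_nat_of_succ_lt fun i => D_succ_ssubset G (h i) hne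
  exact not_injective_infinite_finite _ hanti.injective

theorem exists_strongHull_eq_D [Finite V] (G : SimpleGraph V) {v w : V} (hne : w ≠ v) :
    ∃ i, w ∈ D G i v ∧ strongHull G v w = D G i v := by
  classical
  have h := exists_notMem_D G hne
  have hpos : Nat.find h ≠ 0 := fun h0 => by
    have := Nat.find_spec h
    rw [h0] at this
    exact this (Set.mem_univ w)
  -- The level wanted is the one just before the first that misses `w`.
  obtain ⟨i, hi⟩ := Nat.exists_eq_succ_of_ne_zero hpos
  have hw : w ∈ D G i v := not_not.1 (Nat.find_min h (hi ▸ i.lt_succ_self))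
  exact ⟨i, hw, strongHull_eq_D G hw (by have := Nat.find_spec h; rwa [hi] at this)⟩

/-- The sizes of the strong hulls of `v` with another vertex that contain `w`. -/
def hullSizes (G : SimpleGraph V) (v w : V) : Set ℕ :=
  {n | ∃ w', (strongHull G v w').ncard = n ∧ w ∈ strongHull G v w'}

/-- If `w` lies in `D G i v`, the levels `0, …, i` contribute `i + 1` distinct sizes; if not, only
levels below `i` can contribute. The case `w = v` must be excluded, since `v` lies in every level
while the number of sizes is finite. -/
theorem mem_D_iff_lt_ncard_hullSizes [Finite V] (G : SimpleGraph V) (i : ℕ) {v w : V}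
    (hne : w ≠ v) : w ∈ D G i v ↔ i < (hullSizes G v w).ncard := by
  constructor
  · intro hw
    have hfin : (hullSizes G v w).Finite :=
      (Set.finite_range fun w' => (strongHull G v w').ncard).subset
        fun n ⟨w', h, _⟩ => ⟨w', h⟩
    have hwj : ∀ j ≤ i, w ∈ D G j v := fun j hj => D_antitone G v hj hw
    have hmaps : ∀ j ∈ Set.Iic i, (D G j v).ncard ∈ hullSizes G v w := by
      intro j hj
      -- A vertex lost between levels `j` and `j + 1` exhibits level `j` as a strong hull.
      obtain ⟨w', hw', hw''⟩ := Set.exists_of_ssubset (D_succ_ssubset G (hwj j hj) hne)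
      have := strongHull_eq_D G hw' hw''
      exact ⟨w', by rw [this], this ▸ hwj j hj⟩
    have hinj : Set.InjOn (fun j => (D G j v).ncard) (Set.Iic i) := by
      have hlt : ∀ a b, a < b → b ≤ i → (D G b v).ncard < (D G a v).ncard := by
        intro a b hab hb
        refine Set.ncard_lt_ncard ?_ (Set.toFinite _)
        exact lt_of_le_of_lt (D_antitone G v (Nat.succ_le_of_lt hab))
          (D_succ_ssubset G (hwj a (hab.le.trans hb)) hne)
      intro a ha b hb hab
      rcases lt_trichotomy a b with h | h | h
      · exact absurd hab (hlt a b h hb).ne'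
      · exact h
      · exact absurd hab (hlt b a h ha).ne
    have := Set.ncard_le_ncard_of_injOn _ hmaps hinj hfin
    rw [← Finset.coe_Iic, Set.ncard_coe_finset, Nat.card_Iic] at this
    omega
  · intro hi
    by_contra hw
    have hsub : hullSizes G v w ⊆ (fun j => (D G j v).ncard) '' Set.Iio i := by
      rintro n ⟨w', hn, hw'⟩
      -- The degenerate hull `{v}` obtained from `w' = v` is not counted, as it misses `w`.
      have hne' : w' ≠ v := by
        rintro rfl
        rw [strongHull_self] at hw'
        exact hne hw'
      obtain ⟨j, -, hj⟩ := exists_strongHull_eq_D G hne'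
      rw [hj] at hn hw'
      exact ⟨j, not_le.1 fun hij => hw (D_antitone G v hij hw'), hn⟩
    have h1 := Set.ncard_le_ncard hsub ((Set.finite_Iio i).image _)
    have h2 := Set.ncard_image_le (f := fun j => (D G j v).ncard) (Set.finite_Iio i)
    rw [← Finset.coe_Iio, Set.ncard_coe_finset, Nat.card_Iio, Finset.coe_Iio] at h2
    omega

/-! ### The module hull as a symmetric transitive closure -/

/-- Gallai's relation on ordered pairs: a pair may be swapped, and `(a, b)` may be replaced by
`(a, b')` if `ab` and `ab'` are both edges and `bb'` is a nonedge, or conversely. -/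
def PairStep (G : SimpleGraph V) (a b a' b' : V) : Prop :=
  (a = b' ∧ b = a') ∨
    (a = a' ∧ a ≠ b ∧ a ≠ b' ∧ b ≠ b' ∧ (G.Adj a b ↔ G.Adj a b') ∧ (G.Adj a b ↔ ¬ G.Adj b b'))

/-- Makes the symmetrization in `stc` harmless: it adds no steps. -/
theorem PairStep.symm {G : SimpleGraph V} {a b a' b' : V} (h : PairStep G a b a' b') :
    PairStep G a' b' a b := by
  rcases h with ⟨rfl, rfl⟩ | ⟨rfl, h1, h2, h3, h4, h5⟩
  · exact Or.inl ⟨rfl, rfl⟩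
  · exact Or.inr ⟨rfl, h2, h1, h3.symm, h4.symm, by rw [← h4, h5, G.adj_comm]⟩

/-- A step adds only a vertex that distinguishes the two vertices of the current pair, so every
module containing the pair contains it too. Conversely, the vertices reached form a module: an
outside vertex distinguishing a reached pair could be added by a step, and consecutive pairs share a
vertex, so an outside vertex sees all reached vertices alike. -/
theorem mem_moduleHull_iff_exists_transGen (G : SimpleGraph V) (v w u : V) :
    u ∈ moduleHull G v w ↔
      ∃ t, Relation.TransGen (fun p q : V × V => PairStep G p.1 p.2 q.1 q.2) (v, w) (u, t) := by
  set R := fun p q : V × V => PairStep G p.1 p.2 q.1 q.2 with hR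
  have swap : ∀ p : V × V, R p p.swap := fun p => Or.inl ⟨rfl, rfl⟩
  -- `TransGen` has no empty path; swapping twice replaces it.
  have refl : ∀ p, Relation.TransGen R p p := fun p => .tail (.single (swap p)) (swap p.swap)
  constructor
  · intro h
    set S : Set V := {u | ∃ t, Relation.TransGen R (v, w) (u, t)} with hS
    have hpair : ∀ {p}, Relation.TransGen R (v, w) p → p.1 ∈ S ∧ p.2 ∈ S :=
      fun {p} hp => ⟨⟨p.2, hp⟩, ⟨p.1, hp.tail (swap p)⟩⟩
    refine h S ⟨⟨v, w, refl _⟩, ?_⟩ (hpair (refl _)).1 (hpair (refl _)).2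
    intro x hx
    have hxp : ∀ p, Relation.TransGen R (v, w) p → (G.Adj x p.1 ↔ G.Adj x p.2) := by
      rintro ⟨a, b⟩ hp
      have hxa : a ≠ x := fun h => hx (h ▸ (hpair hp).1)
      have hxb : b ≠ x := fun h => hx (h ▸ (hpair hp).2)
      by_contra hcon
      have hab : a ≠ b := fun h => hcon (by simp [h])
      -- If `x` separates `a` and `b`, one of these two steps is legal: the one that keeps the
      -- vertex whose adjacency to `x` agrees with the adjacency of `a` and `b`.
      have h1 : ¬ R (a, b) (a, x) := fun hs => hx (hpair (hp.tail hs)).2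
      have h2 : ¬ R (b, a) (b, x) := fun hs => hx (hpair ((hp.tail (swap _)).tail hs)).2
      simp only [hR, PairStep, not_or, not_and] at h1 h2
      have h1 := h1.2 trivial hab hxa hxb
      have h2 := h2.2 trivial hab.symm hxb hxa
      rw [G.adj_comm b a] at h2
      rw [G.adj_comm a x, G.adj_comm b x] at h1 h2
      simp only at hcon
      tauto
    have hinv : ∀ p, Relation.TransGen R (v, w) p → (G.Adj x p.1 ↔ G.Adj x v) := by
      intro p hp
      have hstep : ∀ {p q}, Relation.TransGen R (v, w) p → R p q →
          (G.Adj x q.1 ↔ G.Adj x p.1) := by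
        rintro p q hp (⟨-, h⟩ | ⟨h, -⟩)
        · rw [← h, hxp p hp]
        · rw [← h]
      induction hp with
      | single h => exact hstep (refl _) h
      | tail hp h ih => exact (hstep hp h).trans ih
    rintro y ⟨t, hy⟩ z ⟨t', hz⟩
    rw [hinv _ hy, hinv _ hz]
  · rintro ⟨t, ht⟩ X hX hv hw
    have key : ∀ p q, R p q → p.1 ∈ X ∧ p.2 ∈ X → q.1 ∈ X ∧ q.2 ∈ X := by
      rintro ⟨a, b⟩ ⟨a', b'⟩ (⟨h1, h2⟩ | ⟨h, -, -, -, h4, h5⟩) ⟨ha, hb⟩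
      · simp only at h1 h2 ha hb
        subst h1 h2
        exact ⟨hb, ha⟩
      · simp only at h h4 h5 ha hb
        subst h
        refine ⟨ha, ?_⟩
        by_contra hb'
        have := hX.2 b' hb' a ha b hb
        rw [G.adj_comm b' a, G.adj_comm b' b] at this
        tauto
    have : ∀ q, Relation.TransGen R (v, w) q → q.1 ∈ X ∧ q.2 ∈ X := by
      intro q hq
      induction hq with
      | single h => exact key _ _ h ⟨hv, hw⟩
      | tail _ h ih => exact key _ _ h ih
    exact (this _ ht).1

end ModDecomp


/-! ### Derived connectives, short tuples and counting of single variables in STC+C -/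

namespace STCC

open FirstOrder

variable {L : Language} {U : Type*}

namespace Formula

/-- Disjunction. -/
def or (φ ψ : Formula L) : Formula L := neg (and (neg φ) (neg ψ))

/-- Biimplication. -/
def iff (φ ψ : Formula L) : Formula L := neg (or (and φ (neg ψ)) (and ψ (neg φ)))

theorem holds_or (A : L.Structure U) (φ ψ : Formula L) (α : Assignment U) :
    (φ.or ψ).Holds A α ↔ φ.Holds A α ∨ ψ.Holds A α := by
  simp only [or, Holds]
  tauto

theorem holds_iff (A : L.Structure U) (φ ψ : Formula L) (α : Assignment U) :
    (φ.iff ψ).Holds A α ↔ (φ.Holds A α ↔ ψ.Holds A α) := by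
  simp only [iff, holds_or, Holds]
  tauto

theorem free_or (φ ψ : Formula L) : (φ.or ψ).free = φ.free ∪ ψ.free := rfl

theorem free_iff (φ ψ : Formula L) : (φ.iff ψ).free = φ.free ∪ ψ.free := by
  ext
  simp only [iff, free_or, free, Finset.mem_union]
  tauto

/-- Adjacency of two structure variables. -/
def adj (x y : ℕ) : Formula Language.graph := rel Language.adj ![x, y]

theorem holds_adj (G : SimpleGraph U) (x y : ℕ) (α : Assignment U) :
    (adj x y).Holds G.structure α ↔ G.Adj (α.str x) (α.str y) := Iff.rfl

theorem free_adj (x y : ℕ) : (adj x y).free = {.str x, .str y} := by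
  ext
  simp [adj, free, eq_comm]

end Formula

/-- The pair of two structure variables. -/
def VarTuple.pair (x y : ℕ) : VarTuple 2 0 := ⟨![x, y], Fin.elim0⟩

theorem VarTuple.pair_distinct {x y : ℕ} (h : x ≠ y) : (VarTuple.pair x y).Distinct := by
  refine ⟨?_, fun i => i.elim0⟩
  intro i j hij
  fin_cases i <;> fin_cases j <;> simp_all [VarTuple.pair]

theorem VarTuple.vars_pair (x y : ℕ) : (VarTuple.pair x y).vars = {.str x, .str y} := by
  ext
  simp [VarTuple.pair, VarTuple.vars, eq_comm]

/-- The tuple consisting of one structure variable. -/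
def VarTuple.singleStr (x : ℕ) : VarTuple 1 0 := ⟨![x], Fin.elim0⟩

/-- The tuple consisting of one number variable. -/
def VarTuple.singleNum (n : ℕ) : VarTuple 0 1 := ⟨Fin.elim0, ![n]⟩

theorem VarTuple.singleStr_distinct (x : ℕ) : (VarTuple.singleStr x).Distinct :=
  ⟨Function.injective_of_subsingleton _, Function.injective_of_subsingleton _⟩

theorem VarTuple.singleNum_distinct (n : ℕ) : (VarTuple.singleNum n).Distinct :=
  ⟨Function.injective_of_subsingleton _, Function.injective_of_subsingleton _⟩

theorem VarTuple.vars_singleStr (x : ℕ) : (VarTuple.singleStr x).vars = {.str x} := by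
  ext
  simp [VarTuple.singleStr, VarTuple.vars]

theorem VarTuple.vars_singleNum (n : ℕ) : (VarTuple.singleNum n).vars = {.num n} := by
  ext
  simp [VarTuple.singleNum, VarTuple.vars]

namespace Assignment

theorem setTuple_pair_left (α : Assignment U) {x y : ℕ} (h : x ≠ y) (a : Tuple U 2 0) :
    (α.setTuple (VarTuple.pair x y) a).str x = a.1 0 :=
  (VarTuple.pair_distinct h).1.extend_apply a.1 α.str 0

theorem setTuple_pair_right (α : Assignment U) {x y : ℕ} (h : x ≠ y) (a : Tuple U 2 0) :
    (α.setTuple (VarTuple.pair x y) a).str y = a.1 1 :=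
  (VarTuple.pair_distinct h).1.extend_apply a.1 α.str 1

theorem setTuple_pair_of_ne (α : Assignment U) {x y z : ℕ} (hx : z ≠ x) (hy : z ≠ y)
    (a : Tuple U 2 0) : (α.setTuple (VarTuple.pair x y) a).str z = α.str z := by
  refine Function.extend_apply' _ _ _ ?_
  rintro ⟨i, hi⟩
  fin_cases i
  · exact hx hi.symm
  · exact hy hi.symm

theorem setTuple_singleStr (α : Assignment U) (x : ℕ) (a : Tuple U 1 0) :
    α.setTuple (VarTuple.singleStr x) a = α.setStr x (a.1 0) := by
  have h := VarTuple.singleStr_distinct x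
  unfold setTuple setStr
  congr 1
  · funext z
    by_cases hz : z = x
    · subst hz
      rw [Function.update_self]
      exact h.1.extend_apply a.1 α.str 0
    · rw [Function.update_of_ne hz]
      refine Function.extend_apply' _ _ _ ?_
      rintro ⟨i, hi⟩
      fin_cases i
      exact hz hi.symm
  · funext z
    exact Function.extend_apply' _ _ _ fun ⟨i, _⟩ => i.elim0

theorem setTuple_singleNum (α : Assignment U) (n : ℕ) (a : Tuple U 0 1) :
    α.setTuple (VarTuple.singleNum n) a = α.setNum n (a.2 0) := by
  have h := VarTuple.singleNum_distinct n
  unfold setTuple setNum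
  congr 1
  · funext z
    exact Function.extend_apply' _ _ _ fun ⟨i, _⟩ => i.elim0
  · funext z
    by_cases hz : z = n
    · subst hz
      rw [Function.update_self]
      exact h.2.extend_apply a.2 α.num 0
    · rw [Function.update_of_ne hz]
      refine Function.extend_apply' _ _ _ ?_
      rintro ⟨i, hi⟩
      fin_cases i
      exact hz hi.symm

theorem str_setStr_self (α : Assignment U) (x : ℕ) (a : U) : (α.setStr x a).str x = a :=
  Function.update_self ..

theorem str_setStr_of_ne (α : Assignment U) {x y : ℕ} (h : y ≠ x) (a : U) :
    (α.setStr x a).str y = α.str y :=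
  Function.update_of_ne h ..

theorem num_setStr (α : Assignment U) (x : ℕ) (a : U) : (α.setStr x a).num = α.num := rfl

theorem str_setNum (α : Assignment U) (n : ℕ) (a : NumSort U) : (α.setNum n a).str = α.str := rfl

theorem num_setNum_self (α : Assignment U) (n : ℕ) (a : NumSort U) : (α.setNum n a).num n = a :=
  Function.update_self ..

theorem num_setNum_of_ne (α : Assignment U) {m n : ℕ} (h : m ≠ n) (a : NumSort U) :
    (α.setNum n a).num m = α.num m :=
  Function.update_of_ne h ..

end Assignment

theorem numValue_singleton (n : NumSort U) : numValue (fun _ : Fin 1 => n) = n := by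
  simp [numValue]

namespace Formula

/-- `#x ψ = q` for a structure variable `x`. -/
def countStr (x : ℕ) (ψ : Formula L) (q : ℕ) : Formula L :=
  count (VarTuple.singleStr x) (VarTuple.singleStr_distinct x) ψ ![q]

/-- `#n ψ = q` for a number variable `n`. -/
def countNum (n : ℕ) (ψ : Formula L) (q : ℕ) : Formula L :=
  count (VarTuple.singleNum n) (VarTuple.singleNum_distinct n) ψ ![q]

theorem free_countStr (x : ℕ) (ψ : Formula L) (q : ℕ) :
    (countStr x ψ q).free = (ψ.free \ {.str x}) ∪ {.num q} := by
  simp [countStr, free, VarTuple.vars_singleStr]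

theorem free_countNum (n : ℕ) (ψ : Formula L) (q : ℕ) :
    (countNum n ψ q).free = (ψ.free \ {.num n}) ∪ {.num q} := by
  simp [countNum, free, VarTuple.vars_singleNum]

theorem holds_countStr (A : L.Structure U) (x : ℕ) (ψ : Formula L) (q : ℕ) (α : Assignment U) :
    (countStr x ψ q).Holds A α ↔ {a : U | ψ.Holds A (α.setStr x a)}.ncard = α.num q := by
  have h1 : (fun i : Fin 1 => α.num (![q] i)) = fun _ => α.num q := by
    funext i
    fin_cases i
    rfl
  have h2 : {a : U | ψ.Holds A (α.setStr x a)} = (fun a : Tuple U 1 0 => a.1 0) ''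
      {a | ψ.Holds A (α.setStr x (a.1 0))} := by
    ext a
    exact ⟨fun h => ⟨(fun _ => a, Fin.elim0), h, rfl⟩, fun ⟨b, h, hb⟩ => hb ▸ h⟩
  have h3 : Function.Injective fun a : Tuple U 1 0 => a.1 0 := by
    rintro ⟨a, a'⟩ ⟨b, b'⟩ h
    refine Prod.ext (funext fun i => ?_) (funext fun i => i.elim0)
    fin_cases i
    exact h
  simp only [countStr, Holds, Assignment.setTuple_singleStr]
  rw [h1, numValue_singleton, h2, Set.ncard_image_of_injective _ h3]

theorem holds_countNum (A : L.Structure U) (n : ℕ) (ψ : Formula L) (q : ℕ) (α : Assignment U) :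
    (countNum n ψ q).Holds A α ↔
      {a : NumSort U | ψ.Holds A (α.setNum n a)}.ncard = α.num q := by
  have h1 : (fun i : Fin 1 => α.num (![q] i)) = fun _ => α.num q := by
    funext i
    fin_cases i
    rfl
  have h2 : {a : NumSort U | ψ.Holds A (α.setNum n a)} = (fun a : Tuple U 0 1 => a.2 0) ''
      {a | ψ.Holds A (α.setNum n (a.2 0))} := by
    ext a
    exact ⟨fun h => ⟨(Fin.elim0, fun _ => a), h, rfl⟩, fun ⟨b, h, hb⟩ => hb ▸ h⟩
  have h3 : Function.Injective fun a : Tuple U 0 1 => a.2 0 := by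
    rintro ⟨a, a'⟩ ⟨b, b'⟩ h
    refine Prod.ext (funext fun i => i.elim0) (funext fun i => ?_)
    fin_cases i
    exact h
  simp only [countNum, Holds, Assignment.setTuple_singleNum]
  rw [h1, numValue_singleton, h2, Set.ncard_image_of_injective _ h3]

/-! ### Formulas for the hulls and for the modular decomposition -/

/-- The formula defining `ModDecomp.PairStep`. -/
def pairStep (a b a' b' : ℕ) : Formula Language.graph :=
  or (and (eqStr a b') (eqStr b a'))
    (and (eqStr a a') (and (neg (eqStr a b)) (and (neg (eqStr a b')) (and (neg (eqStr b b'))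
      (and (iff (adj a b) (adj a b')) (iff (adj a b) (neg (adj b b'))))))))

theorem holds_pairStep (G : SimpleGraph U) (a b a' b' : ℕ) (α : Assignment U) :
    (pairStep a b a' b').Holds G.structure α ↔
      ModDecomp.PairStep G (α.str a) (α.str b) (α.str a') (α.str b') := by
  simp only [pairStep, holds_or, holds_iff, Holds, holds_adj, ModDecomp.PairStep, ne_eq]

theorem free_pairStep (a b a' b' : ℕ) :
    (pairStep a b a' b').free ⊆ {.str a, .str b, .str a', .str b'} := by
  intro s
  simp only [pairStep, free_or, free_iff, free, free_adj, Finset.mem_union, Finset.mem_insert,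
    Finset.mem_singleton]
  tauto

/-- The formula defining `u ∈ ModDecomp.moduleHull G v w`, for variables other than `2, …, 6`. -/
def moduleHull (v w u : ℕ) : Formula Language.graph :=
  exStr 6 (stc (VarTuple.pair 2 3) (VarTuple.pair 4 5)
    (VarTuple.pair_distinct (by decide)) (VarTuple.pair_distinct (by decide))
    (by rw [VarTuple.vars_pair, VarTuple.vars_pair]; decide)
    (pairStep 2 3 4 5) (VarTuple.pair v w) (VarTuple.pair u 6))

/-- The arguments of `stc` are evaluated outside the scope of its bound variables `2, …, 5`, so only
the quantified second coordinate `6` can clash with them. -/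
theorem holds_moduleHull (G : SimpleGraph U) {v w u : ℕ} (hv : v ≠ 6) (hw : w ≠ 6) (hu : u ≠ 6)
    (α : Assignment U) :
    (moduleHull v w u).Holds G.structure α ↔
      α.str u ∈ ModDecomp.moduleHull G (α.str v) (α.str w) := by
  rw [ModDecomp.mem_moduleHull_iff_exists_transGen]
  simp only [moduleHull, Holds, holds_pairStep, SymTransClosure]
  refine exists_congr fun t => ?_
  set R : Tuple U 2 0 → Tuple U 2 0 → Prop := fun a b =>
    ModDecomp.PairStep G (a.1 0) (a.1 1) (b.1 0) (b.1 1) with hR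
  have hval : ∀ a b : Tuple U 2 0, ∀ β : Assignment U,
      ModDecomp.PairStep G
        (((β.setTuple (VarTuple.pair 2 3) a).setTuple (VarTuple.pair 4 5) b).str 2)
        (((β.setTuple (VarTuple.pair 2 3) a).setTuple (VarTuple.pair 4 5) b).str 3)
        (((β.setTuple (VarTuple.pair 2 3) a).setTuple (VarTuple.pair 4 5) b).str 4)
        (((β.setTuple (VarTuple.pair 2 3) a).setTuple (VarTuple.pair 4 5) b).str 5) = R a b := by
    intro a b β
    rw [Assignment.setTuple_pair_left _ (show 4 ≠ 5 by decide),
      Assignment.setTuple_pair_right _ (show 4 ≠ 5 by decide),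
      Assignment.setTuple_pair_of_ne _ (show 2 ≠ 4 by decide) (show 2 ≠ 5 by decide),
      Assignment.setTuple_pair_of_ne _ (show 3 ≠ 4 by decide) (show 3 ≠ 5 by decide),
      Assignment.setTuple_pair_left _ (show 2 ≠ 3 by decide),
      Assignment.setTuple_pair_right _ (show 2 ≠ 3 by decide)]
  simp only [hval]
  have heval : ∀ (β : Assignment U) (x y : ℕ),
      β.eval (VarTuple.pair x y) = ((![β.str x, β.str y], Fin.elim0) : Tuple U 2 0) := by
    intro β x y
    refine Prod.ext (funext fun i => ?_) (funext fun i => i.elim0)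
    fin_cases i <;> rfl
  rw [heval, heval, Assignment.str_setStr_of_ne _ hv, Assignment.str_setStr_of_ne _ hw,
    Assignment.str_setStr_of_ne _ hu, Assignment.str_setStr_self]
  constructor
  · intro h
    -- Paths are carried between `Tuple U 2 0` and `U × U`; backward steps are reversed by symmetry.
    refine Relation.TransGen.lift (fun a : Tuple U 2 0 => (a.1 0, a.1 1)) ?_ _ _ h
    rintro a b (h | h)
    · exact h
    · exact h.symm
  · intro h
    exact Relation.TransGen.lift
      (fun p : U × U => ((![p.1, p.2], Fin.elim0) : Tuple U 2 0)) (fun _ _ h => Or.inl h) _ _ h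

theorem free_moduleHull (v w u : ℕ) :
    (moduleHull v w u).free ⊆ {.str v, .str w, .str u} := by
  intro s hs
  have := @free_pairStep 2 3 4 5 s
  simp only [moduleHull, free, VarTuple.vars_pair, Finset.mem_union, Finset.mem_sdiff,
    Finset.mem_insert, Finset.mem_singleton] at *
  tauto

/-- The formula defining `u ∈ ModDecomp.strongHull G v w`. -/
def strongHull (v w u : ℕ) : Formula Language.graph :=
  or (moduleHull v w u) (neg (moduleHull v u w))

theorem holds_strongHull (G : SimpleGraph U) {v w u : ℕ} (hv : v ≠ 6) (hw : w ≠ 6) (hu : u ≠ 6)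
    (α : Assignment U) :
    (strongHull v w u).Holds G.structure α ↔
      α.str u ∈ ModDecomp.strongHull G (α.str v) (α.str w) := by
  simp only [strongHull, holds_or, Holds, holds_moduleHull G hv hw hu,
    holds_moduleHull G hv hu hw]
  rfl

theorem free_strongHull (v w u : ℕ) :
    (strongHull v w u).free ⊆ {.str v, .str w, .str u} := by
  refine Finset.union_subset (free_moduleHull v w u) ((free_moduleHull v u w).trans ?_)
  intro s
  simp only [Finset.mem_insert, Finset.mem_singleton]
  tauto

/-- The formula defining `n ∈ ModDecomp.hullSizes G v w` for the number variable `n = 1` and the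
structure variables `v = 0` and `w = 1`. -/
def hullSizes : Formula Language.graph :=
  exStr 7 (and (countStr 8 (strongHull 0 7 8) 1) (strongHull 0 7 1))

theorem holds_hullSizes (G : SimpleGraph U) (α : Assignment U) :
    hullSizes.Holds G.structure α ↔
      (α.num 1 : ℕ) ∈ ModDecomp.hullSizes G (α.str 0) (α.str 1) := by
  simp only [hullSizes, Holds, holds_countStr, ModDecomp.hullSizes]
  refine exists_congr fun a => and_congr ?_ ?_
  · simp only [holds_strongHull G (show 0 ≠ 6 by decide) (show 7 ≠ 6 by decide)
      (show 8 ≠ 6 by decide), Assignment.str_setStr_self, Assignment.num_setStr,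
      Assignment.str_setStr_of_ne _ (show 0 ≠ 8 by decide),
      Assignment.str_setStr_of_ne _ (show 7 ≠ 8 by decide),
      Assignment.str_setStr_of_ne _ (show 0 ≠ 7 by decide)]
    rfl
  · rw [holds_strongHull G (by decide) (by decide) (by decide), Assignment.str_setStr_self,
      Assignment.str_setStr_of_ne _ (by decide), Assignment.str_setStr_of_ne _ (by decide)]

theorem free_hullSizes : hullSizes.free ⊆ {.num 1, .str 0, .str 1} := by
  intro s hs
  have h1 := @free_strongHull 0 7 8 s
  have h2 := @free_strongHull 0 7 1 s
  simp only [hullSizes, free, free_countStr, Finset.mem_union, Finset.mem_sdiff,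
    Finset.mem_insert, Finset.mem_singleton] at *
  tauto

/-- The formula `φ_D(p, x, z)` that defines the modular decomposition, for `p = 0`, `x = 0`
and `z = 1`. -/
def modularDecomposition : Formula Language.graph :=
  or (eqStr 0 1) (neg (exNum 2 (and (le 2 0) (countNum 1 hullSizes 2))))

theorem free_modularDecomposition :
    modularDecomposition.free ⊆ {.num 0, .str 0, .str 1} := by
  intro s hs
  have h1 := @free_hullSizes s
  simp only [modularDecomposition, free_or, free, free_countNum, Finset.mem_union,
    Finset.mem_sdiff, Finset.mem_insert, Finset.mem_singleton] at *
  tauto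

theorem holds_modularDecomposition [Finite U] (G : SimpleGraph U) (α : Assignment U) :
    modularDecomposition.Holds G.structure α ↔
      α.str 1 ∈ ModDecomp.D G (α.num 0) (α.str 0) := by
  have hcard : {n : NumSort U | hullSizes.Holds G.structure ((α.setNum 2 0).setNum 1 n)}.ncard =
      (ModDecomp.hullSizes G (α.str 0) (α.str 1)).ncard := by
    rw [← Set.ncard_image_of_injective _ Fin.val_injective]
    congr 1
    ext n
    simp only [holds_hullSizes, Assignment.num_setNum_self, Assignment.str_setNum]
    constructor
    · rintro ⟨m, hm, rfl⟩
      exact hm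
    · intro h
      obtain ⟨w', hw', -⟩ := id h
      -- Every hull size is at most the number of vertices, so counting within the number sort
      -- misses none.
      have hn : n < Nat.card U + 1 := by
        rw [← hw']
        exact Nat.lt_succ_of_le (Set.ncard_le_card _)
      exact ⟨⟨n, hn⟩, h, rfl⟩
  simp only [holds_hullSizes, Assignment.num_setNum_self, Assignment.str_setNum] at hcard
  simp only [modularDecomposition, holds_or, Holds, holds_countNum, holds_hullSizes,
    Assignment.num_setNum_self, Assignment.str_setNum,
    Assignment.num_setNum_of_ne _ (show 0 ≠ 2 by decide), hcard]
  -- The disjunct `eqStr 0 1` covers the case excluded from the counting criterion.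
  by_cases hne : α.str 1 = α.str 0
  · rw [hne]
    simp [ModDecomp.mem_D]
  · rw [ModDecomp.mem_D_iff_lt_ncard_hullSizes G _ hne]
    simp only [Ne.symm hne, false_or, not_exists, not_and]
    constructor
    · intro h
      by_contra! hle
      -- "More than `i` sizes" is phrased as "no `q ≤ i` is the number of sizes", so that number has
      -- to be in the number sort only when it is at most `i`, where this is automatic.
      exact h ⟨_, hle.trans_lt (α.num 0).isLt⟩ hle rfl
    · intro h q hq hq'
      rw [hq'] at h
      exact absurd h (not_lt.2 hq)

end Formula

end STCC

/-- There is an STC+C-formula `φ(p, x, z)` that defines, in every finite graph `G`, for every number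
`i` of the number sort and every vertex `v`, the set `D_{i,v}` of the modular decomposition. -/
theorem mainTheorem2 :
    ∃ (φ : STCC.Formula FirstOrder.Language.graph) (p x z : ℕ),
      x ≠ z ∧ φ.free ⊆ {STCC.Var.num p, STCC.Var.str x, STCC.Var.str z} ∧
      ∀ (V : Type*) [Finite V] (G : SimpleGraph V) (i : STCC.NumSort V) (v : V)
        (α : STCC.Assignment V),
        {w : V | φ.Holds G.structure (((α.setNum p i).setStr x v).setStr z w)} =
          ModDecomp.D G i v := by
  refine ⟨.modularDecomposition, 0, 0, 1, by decide,
    STCC.Formula.free_modularDecomposition, fun V _ G i v α => ?_⟩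
  ext w
  refine (STCC.Formula.holds_modularDecomposition G _).trans ?_
  rw [STCC.Assignment.str_setStr_self, STCC.Assignment.str_setStr_of_ne _ (by decide),
    STCC.Assignment.str_setStr_self, STCC.Assignment.num_setStr, STCC.Assignment.num_setStr,
    STCC.Assignment.num_setNum_self]
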